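/- Let $y\in\mathbb R^n$, $X\in\mathbb R^{n\times p}$, $Z\in\mathbb R^{n\times q}$ be fixed ($n,p,q\ge 1$), and put $P_Z=Z(Z^TZ)^{-1}Z^T$. Assume that $Z^TZ$ and $X^TP_ZX$ are non-singular. Let $X=U_X\Sigma_XV_X^T$ and $Z=U_Z\Sigma_ZV_Z^T$ be thin singular value decompositions ($U_X\in\mathbb R^{n\times p}$ and $U_Z\in\mathbb R^{n\times q}$ have orthonormal columns). Define $$\widehat\beta_{2SLS}=(X^TP_ZX)^{-1}X^TP_Zy,\qquad \widehat e=y-X\widehat\beta_{2SLS}.$$ Let $\Pi\in\mathbb R^{m\times n}$ be a countsketch: a random matrix with independent columns, each of which has exactly one non-zero entry, located uniformly at random among the $m$ rows and equal to $+1$ or $-1$ with probability $1/2$ each, independently of its location. Put $\widetilde X=\Pi X$, $\widetilde Z=\Pi Z$, $\widetilde y=\Pi y$ and $$\widetilde\beta_{2SLS}=(\widetilde X^TP_{\widetilde Z}\widetilde X)^{-1}\widetilde X^TP_{\widetilde Z}\widetilde y.$$ Write $\|\cdot\|$ for the Euclidean norm and $\sigma_{\min}$ for the smallest singular value. Let $\varepsilon\in(0,1/3]$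 and $\delta\in(0,1)$ be such that $$m\ \ge\ \frac{\max\{q(q+1),\,2pq\}}{\varepsilon^2\delta}\qquad\text{and}\qquad \sigma_{\min}^2(U_Z^TU_X)\ \ge\ \frac{16\varepsilon(1+\varepsilon)}{1-\varepsilon}.$$ Then, with probability at least $1-\delta$, the matrices $\widetilde Z^T\widetilde Z$ and $\widetilde X^TP_{\widetilde Z}\widetilde X$ are non-singular (so that $\widetilde\beta_{2SLS}$ is well defined) and $$\big\|\widetilde\beta_{2SLS}-\widehat\beta_{2SLS}\big\|\ \le\ \frac{4\varepsilon}{1-\varepsilon}\left[2+\frac{3\|\widehat e\|}{\sqrt p}\right]\frac{1}{\sigma_{\min}(X)\,\sigma_{\min}^2(U_Z^TU_X)}.$$ -/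

import Mathlib

open MeasureTheory ProbabilityTheory Matrix

/-- The matrix `P_Z = Z (Zᵀ Z)⁻¹ Zᵀ`, the orthogonal projection onto the column space of `Z`
when `Zᵀ Z` is non-singular. -/
noncomputable def projMatrix {n q : ℕ} (Z : Matrix (Fin n) (Fin q) ℝ) :
    Matrix (Fin n) (Fin n) ℝ :=
  Z * (Zᵀ * Z)⁻¹ * Zᵀ

/-- The two-stage least squares estimator `(Xᵀ P_Z X)⁻¹ Xᵀ P_Z y`. -/
noncomputable def twoSLS {n p q : ℕ} (X : Matrix (Fin n) (Fin p) ℝ)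
    (Z : Matrix (Fin n) (Fin q) ℝ) (y : Fin n → ℝ) : Fin p → ℝ :=
  (Xᵀ * projMatrix Z * X)⁻¹ *ᵥ (Xᵀ *ᵥ (projMatrix Z *ᵥ y))

/-- The residual vector `y - X β` at the two-stage least squares estimator `β`. -/
noncomputable def twoSLSResidual {n p q : ℕ} (X : Matrix (Fin n) (Fin p) ℝ)
    (Z : Matrix (Fin n) (Fin q) ℝ) (y : Fin n → ℝ) : Fin n → ℝ :=
  y - X *ᵥ twoSLS X Z y

/-- The Euclidean norm of a real vector. -/
noncomputable def euclNorm {k : ℕ} (v : Fin k → ℝ) : ℝ :=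
  ‖(WithLp.toLp 2 v : EuclideanSpace ℝ (Fin k))‖

/-- The smallest of the `min a b` singular values of an `a × b` real matrix
(Mathlib lists the singular values in decreasing order, starting with index `0`). -/
noncomputable def sigmaMin {a b : ℕ} (A : Matrix (Fin a) (Fin b) ℝ) : ℝ :=
  (Matrix.toEuclideanLin A).singularValues (min a b - 1)

/-- `A = U Σ Vᵀ` is a (thin) singular value decomposition of the `n × k` matrix `A`: the columns
of the `n × k` matrix `U` are orthonormal, `Σ` is the `k × k` diagonal matrix with non-negative
diagonal `σ`, and `V` is a `k × k` orthogonal matrix. -/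
structure IsThinSVD {n k : ℕ} (A U : Matrix (Fin n) (Fin k) ℝ) (σ : Fin k → ℝ)
    (V : Matrix (Fin k) (Fin k) ℝ) : Prop where
  orthonormal : Uᵀ * U = 1
  nonneg : ∀ i, 0 ≤ σ i
  orthogonal : V ∈ Matrix.orthogonalGroup (Fin k) ℝ
  eq : A = U * Matrix.diagonal σ * Vᵀ

/-- A random `m × n` matrix `S` is a countsketch: its columns are independent, and each column has
exactly one non-zero entry, whose position is uniform on the `m` rows and whose value is `1` or
`-1` with equal probability; that is, each of the `2 m` vectors `± e_k` is the value of a given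
column with probability `1 / (2 m)`. -/
structure IsCountSketch {Ω : Type*} [MeasurableSpace Ω] (μ : Measure Ω) {m n : ℕ}
    (S : Ω → Matrix (Fin m) (Fin n) ℝ) : Prop where
  measurable : ∀ j, Measurable (fun ω k => S ω k j)
  indep : iIndepFun (fun (j : Fin n) (ω : Ω) (k : Fin m) => S ω k j) μ
  law_pos : ∀ j k, μ.real {ω | (fun i => S ω i j) = Pi.single k (1 : ℝ)} = 1 / (2 * (m : ℝ))
  law_neg : ∀ j k, μ.real {ω | (fun i => S ω i j) = Pi.single k (-1 : ℝ)} = 1 / (2 * (m : ℝ))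

/-! For a countsketch `S`, the error `(Su)·(Sv) - u·v` involves only Gram entries of distinct
columns. By independence and symmetric signs these are uncorrelated up to swapping the two columns,
so the mean square error is at most `(|u|²|v|² + (u·v)²)/m` (`integral_sketch_dotProduct_sq_le`).

Write `X = UX E` and `Z = UZ D` with `E`, `D` invertible. The factor `D` drops out of the
projection, and `E` only changes coordinates. Put `G = (S UZ)ᵀ(S UZ)`, `W = UZᵀUX`, `W' = (S UZ)ᵀ(S
UX)`. If `d` is the difference of the estimators and `e` the residual, then `w = E d` solves
`(W'ᵀG⁻¹W') w = (S UX)ᵀS f + W'ᵀG⁻¹(S UZ)ᵀS r`, where `f = UZ UZᵀe` and `r = e - f`. The normal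
equations give `UXᵀf = 0`, and `UZᵀr = 0` always, so both noise terms are sketches of vanishing
products and hence small. If `G` is near `1` and `W'` near `W`, the quadratic form on the left stays
coercive with constant of order `σ_min(W)²`; this gives invertibility and the deterministic bound
`twoSLS_sketch_error`.

All requirements enter one nonnegative variable, `sketchDeviation`, whose mean is at most `3ε²δ`. A
single application of Markov's inequality controls them together, with no union bound. -/

/-! ### Second moments of a countsketch. -/

namespace IsCountSketch

variable {Ω : Type*} [MeasurableSpace Ω] {μ : Measure Ω} {m n : ℕ}
  {S : Ω → Matrix (Fin m) (Fin n) ℝ}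

theorem measurable_entry (hS : IsCountSketch μ S) (k : Fin m) (j : Fin n) :
    Measurable (fun ω => S ω k j) :=
  (measurable_pi_apply k).comp (hS.measurable j)

/-- The `2m` prescribed values are distinct and each has mass `1/(2m)`; the total is already one, so
no other value carries mass. -/
theorem ae_col_eq [IsProbabilityMeasure μ] (hS : IsCountSketch μ S) (hm : 0 < m) :
    ∀ᵐ ω ∂μ, ∀ j, ∃ k, (fun i => S ω i j) = Pi.single k (1 : ℝ) ∨
      (fun i => S ω i j) = Pi.single k (-1 : ℝ) := by
  rw [ae_all_iff]
  intro j
  let v : Fin m × Bool → Fin m → ℝ := fun x => Pi.single x.1 (if x.2 then 1 else -1)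
  have hv : Function.Injective v := by
    rintro ⟨k, b⟩ ⟨k', b'⟩ h
    have h1 := congrFun h k
    have hk : k = k' := by
      by_contra hne
      simp only [v, Pi.single_eq_same, Pi.single_eq_of_ne hne] at h1
      split_ifs at h1 <;> norm_num at h1
    subst hk
    cases b <;> cases b' <;> simp [v] at h1 ⊢ <;> norm_num at h1
  let A : Fin m × Bool → Set Ω := fun x => {ω | (fun i => S ω i j) = v x}
  have hA : ∀ x, MeasurableSet (A x) := fun x => hS.measurable j (measurableSet_singleton (v x))
  have hd : Pairwise (Function.onFun Disjoint A) := by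
    intro x x' hx
    refine Set.disjoint_left.2 fun ω h h' => hx (hv ?_)
    exact (h : _ = v x).symm.trans h'
  have hAm : ∀ x, μ.real (A x) = 1 / (2 * (m : ℝ)) := by
    rintro ⟨k, b⟩
    cases b
    · simpa [A, v] using hS.law_neg j k
    · simpa [A, v] using hS.law_pos j k
  have hU : μ.real (⋃ x, A x) = 1 := by
    rw [measureReal_iUnion_fintype hd hA]
    have : (m : ℝ) ≠ 0 := by positivity
    simp only [hAm, Finset.sum_const, Finset.card_univ, Fintype.card_prod, Fintype.card_fin,
      Fintype.card_bool, nsmul_eq_mul]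
    push_cast
    field_simp
  have hae : ∀ᵐ ω ∂μ, ω ∈ ⋃ x, A x := by
    have h1 : μ (⋃ x, A x) = 1 := by
      rw [measureReal_def] at hU
      rwa [← ENNReal.toReal_eq_one_iff]
    exact (mem_ae_iff_prob_eq_one (MeasurableSet.iUnion hA)).2 h1
  filter_upwards [hae] with ω hω
  obtain ⟨⟨k, b⟩, h⟩ := Set.mem_iUnion.1 hω
  refine ⟨k, ?_⟩
  cases b
  · right; simpa [A, v] using h
  · left; simpa [A, v] using h

theorem ae_entry [IsProbabilityMeasure μ] (hS : IsCountSketch μ S) (hm : 0 < m) :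
    ∀ᵐ ω ∂μ, (∀ k j, |S ω k j| ≤ 1) ∧ (∀ j, ∑ k, S ω k j * S ω k j = 1) ∧
      (∀ k k' j, k ≠ k' → S ω k j * S ω k' j = 0) ∧
      (∀ j l, |∑ k, S ω k j * S ω k l| ≤ 1) := by
  filter_upwards [hS.ae_col_eq hm] with ω h
  have key : ∀ j, ∃ a, ∃ s : ℝ, |s| = 1 ∧ ∀ k, S ω k j = if k = a then s else 0 := by
    intro j
    obtain ⟨a, ha | ha⟩ := h j
    · exact ⟨a, 1, by simp, fun k => by simpa [Pi.single_apply] using congrFun ha k⟩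
    · exact ⟨a, -1, by simp, fun k => by simpa [Pi.single_apply] using congrFun ha k⟩
  have hb : ∀ k j, |S ω k j| ≤ 1 := by
    intro k j
    obtain ⟨a, s, hs, H⟩ := key j
    rw [H]; split_ifs <;> simp [hs]
  refine ⟨hb, ?_, ?_, ?_⟩
  · intro j
    obtain ⟨a, s, hs, H⟩ := key j
    simp [H, ← abs_mul_abs_self s, hs]
  · intro k k' j hk
    obtain ⟨a, s, hs, H⟩ := key j
    rw [H, H]; split_ifs <;> simp_all
  · intro j l
    obtain ⟨a, s, hs, H⟩ := key j
    simp [H, abs_mul, hs, hb]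

theorem ae_entry_eq_indicator [IsProbabilityMeasure μ] (hS : IsCountSketch μ S) (hm : 0 < m)
    (k : Fin m) (j : Fin n) : ∀ᵐ ω ∂μ,
    S ω k j = Set.indicator {ω | (fun i => S ω i j) = Pi.single k (1 : ℝ)} 1 ω -
      Set.indicator {ω | (fun i => S ω i j) = Pi.single k (-1 : ℝ)} 1 ω ∧
    S ω k j * S ω k j = Set.indicator {ω | (fun i => S ω i j) = Pi.single k (1 : ℝ)} 1 ω +
      Set.indicator {ω | (fun i => S ω i j) = Pi.single k (-1 : ℝ)} 1 ω := by
  filter_upwards [hS.ae_col_eq hm] with ω h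
  obtain ⟨a, ha | ha⟩ := h j <;>
  · have := congrFun ha k
    beta_reduce at this
    rw [this]
    simp only [Set.indicator_apply, Set.mem_ofPred_eq, ha]
    by_cases hka : k = a
    · subst hka
      have h1 : (Pi.single k (1 : ℝ) : Fin m → ℝ) ≠ Pi.single k (-1 : ℝ) := fun h => by
        have := congrFun h k; simp at this; norm_num at this
      simp [h1, h1.symm]
    · have h1 : ∀ s t : ℝ, s ≠ 0 → (Pi.single a s : Fin m → ℝ) ≠ Pi.single k t :=
          fun s t hs h => by
        have := congrFun h a; simp [Ne.symm hka, hs] at this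
      simp [h1, Pi.single_eq_of_ne hka]

theorem integrable_indicator_col [IsProbabilityMeasure μ] (hS : IsCountSketch μ S) (j : Fin n)
    (v : Fin m → ℝ) :
    Integrable (Set.indicator {ω | (fun i => S ω i j) = v} (1 : Ω → ℝ)) μ :=
  (integrable_const (1 : ℝ)).indicator (hS.measurable j (measurableSet_singleton v))

theorem integral_indicator_col (hS : IsCountSketch μ S) (j : Fin n) (v : Fin m → ℝ) :
    ∫ ω, Set.indicator {ω | (fun i => S ω i j) = v} (1 : Ω → ℝ) ω ∂μ =
      μ.real {ω | (fun i => S ω i j) = v} :=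
  integral_indicator_one (hS.measurable j (measurableSet_singleton v))

theorem integral_entry [IsProbabilityMeasure μ] (hS : IsCountSketch μ S) (hm : 0 < m)
    (k : Fin m) (j : Fin n) : ∫ ω, S ω k j ∂μ = 0 := by
  rw [integral_congr_ae ((hS.ae_entry_eq_indicator hm k j).mono fun ω h => h.1),
    integral_sub (hS.integrable_indicator_col j _) (hS.integrable_indicator_col j _),
    hS.integral_indicator_col, hS.integral_indicator_col, hS.law_pos, hS.law_neg, sub_self]

theorem integral_entry_sq [IsProbabilityMeasure μ] (hS : IsCountSketch μ S) (hm : 0 < m)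
    (k : Fin m) (j : Fin n) : ∫ ω, S ω k j * S ω k j ∂μ = 1 / m := by
  rw [integral_congr_ae ((hS.ae_entry_eq_indicator hm k j).mono fun ω h => h.2),
    integral_add (hS.integrable_indicator_col j _) (hS.integrable_indicator_col j _),
    hS.integral_indicator_col, hS.integral_indicator_col, hS.law_pos, hS.law_neg]
  have : (m : ℝ) ≠ 0 := by positivity
  field_simp
  norm_num

theorem integral_entry_mul [IsProbabilityMeasure μ] (hS : IsCountSketch μ S) (hm : 0 < m)
    (k k' : Fin m) (j : Fin n) :
    ∫ ω, S ω k j * S ω k' j ∂μ = if k = k' then 1 / (m : ℝ) else 0 := by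
  split_ifs with h
  · subst h; exact hS.integral_entry_sq hm k j
  · rw [integral_congr_ae (g := fun _ => (0 : ℝ)), integral_zero]
    filter_upwards [hS.ae_entry hm] with ω hω
    exact hω.2.2.1 k k' j h

theorem measurable_gram (hS : IsCountSketch μ S) (j l : Fin n) :
    Measurable (fun ω => ∑ k, S ω k j * S ω k l) :=
  Finset.measurable_sum _ fun k _ => (hS.measurable_entry k j).mul (hS.measurable_entry k l)

theorem integrable_gram_mul [IsProbabilityMeasure μ] (hS : IsCountSketch μ S) (hm : 0 < m)
    (j l j' l' : Fin n) :
    Integrable (fun ω => (∑ k, S ω k j * S ω k l) * ∑ k, S ω k j' * S ω k l') μ := by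
  refine Integrable.of_bound
    ((hS.measurable_gram j l).mul (hS.measurable_gram j' l')).aestronglyMeasurable 1 ?_
  filter_upwards [hS.ae_entry hm] with ω h
  rw [Real.norm_eq_abs, abs_mul]
  exact mul_le_one₀ (h.2.2.2 j l) (abs_nonneg _) (h.2.2.2 j' l')

/-- Column `j` occurs exactly once in the product, is independent of the other columns (which may
coincide among themselves), and has mean zero. -/
theorem integral_gram_mul_eq_zero [IsProbabilityMeasure μ] (hS : IsCountSketch μ S) (hm : 0 < m)
    {j l j' l' : Fin n} (h1 : j ≠ l) (h2 : j ≠ j') (h3 : j ≠ l') :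
    ∫ ω, (∑ k, S ω k j * S ω k l) * (∑ k, S ω k j' * S ω k l') ∂μ = 0 := by
  have hind := hS.indep.indepFun_finset {j} {l, j', l'} (by simp [h1, h2, h3]) hS.measurable
  have hterm : ∀ k : Fin m,
      ∫ ω, S ω k j * (S ω k l * ∑ i, S ω i j' * S ω i l') ∂μ = 0 := by
    intro k
    have hi : IndepFun (fun ω => S ω k j) (fun ω => S ω k l * ∑ i, S ω i j' * S ω i l') μ :=
      hind.comp
        (φ := fun v : ({j} : Finset (Fin n)) → Fin m → ℝ => v ⟨j, by simp⟩ k)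
        (ψ := fun v : ({l, j', l'} : Finset (Fin n)) → Fin m → ℝ =>
          v ⟨l, by simp⟩ k * ∑ i, v ⟨j', by simp⟩ i * v ⟨l', by simp⟩ i)
        (by fun_prop) (by fun_prop)
    rw [hi.integral_fun_mul_eq_mul_integral (hS.measurable_entry k j).aestronglyMeasurable
      ((hS.measurable_entry k l).mul (hS.measurable_gram j' l')).aestronglyMeasurable,
      hS.integral_entry hm, zero_mul]
  simp only [Finset.sum_mul, mul_assoc]
  rw [integral_finsetSum, Finset.sum_eq_zero fun k _ => hterm k]
  intro k _
  refine Integrable.of_bound ((hS.measurable_entry k j).mul ((hS.measurable_entry k l).mul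
    (hS.measurable_gram j' l'))).aestronglyMeasurable 1 ?_
  filter_upwards [hS.ae_entry hm] with ω h
  rw [Real.norm_eq_abs, abs_mul, abs_mul]
  exact mul_le_one₀ (h.1 k j) (by positivity)
    (mul_le_one₀ (h.1 k l) (abs_nonneg _) (h.2.2.2 j' l'))

/-- Expanding the square over row pairs, independence factors each term; only the `m` diagonal pairs
survive, each equal to `1/m²`. -/
theorem integral_gram_sq [IsProbabilityMeasure μ] (hS : IsCountSketch μ S) (hm : 0 < m)
    {j l : Fin n} (hjl : j ≠ l) :
    ∫ ω, (∑ k, S ω k j * S ω k l) * (∑ k, S ω k j * S ω k l) ∂μ = 1 / m := by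
  have hterm : ∀ k k' : Fin m, ∫ ω, (S ω k j * S ω k' j) * (S ω k l * S ω k' l) ∂μ =
      if k = k' then 1 / (m : ℝ) * (1 / m) else 0 := by
    intro k k'
    have hi : IndepFun (fun ω => S ω k j * S ω k' j) (fun ω => S ω k l * S ω k' l) μ :=
      (hS.indep.indepFun hjl).comp (φ := fun v : Fin m → ℝ => v k * v k')
        (ψ := fun v : Fin m → ℝ => v k * v k')
        (by fun_prop) (by fun_prop)
    rw [hi.integral_fun_mul_eq_mul_integral
      ((hS.measurable_entry k j).mul (hS.measurable_entry k' j)).aestronglyMeasurable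
      ((hS.measurable_entry k l).mul (hS.measurable_entry k' l)).aestronglyMeasurable,
      hS.integral_entry_mul hm, hS.integral_entry_mul hm]
    split_ifs <;> simp
  have hint : ∀ k k' : Fin m,
      Integrable (fun ω => (S ω k j * S ω k' j) * (S ω k l * S ω k' l)) μ := by
    intro k k'
    refine Integrable.of_bound (((hS.measurable_entry k j).mul (hS.measurable_entry k' j)).mul
      ((hS.measurable_entry k l).mul (hS.measurable_entry k' l))).aestronglyMeasurable 1 ?_
    filter_upwards [hS.ae_entry hm] with ω h
    rw [Real.norm_eq_abs, abs_mul, abs_mul, abs_mul]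
    exact mul_le_one₀ (mul_le_one₀ (h.1 k j) (abs_nonneg _) (h.1 k' j)) (by positivity)
      (mul_le_one₀ (h.1 k l) (abs_nonneg _) (h.1 k' l))
  have hexp : ∀ ω, (∑ k, S ω k j * S ω k l) * (∑ k, S ω k j * S ω k l) =
      ∑ k, ∑ k', (S ω k j * S ω k' j) * (S ω k l * S ω k' l) := by
    intro ω
    rw [Finset.sum_mul_sum]
    exact Finset.sum_congr rfl fun k _ => Finset.sum_congr rfl fun k' _ => by ring
  simp only [hexp]
  rw [integral_finsetSum _ fun k _ => integrable_finsetSum _ fun k' _ => hint k k']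
  simp only [integral_finsetSum _ fun k' _ => hint _ k', hterm]
  have : (m : ℝ) ≠ 0 := by positivity
  simp
  field_simp

theorem integral_gram_mul [IsProbabilityMeasure μ] (hS : IsCountSketch μ S) (hm : 0 < m)
    {j l j' l' : Fin n} (h : j ≠ l) (h' : j' ≠ l') :
    ∫ ω, (∑ k, S ω k j * S ω k l) * (∑ k, S ω k j' * S ω k l') ∂μ =
      ((if j = j' ∧ l = l' then 1 else 0) + (if j = l' ∧ l = j' then 1 else 0)) / (m : ℝ) := by
  have hcomm : ∀ ω (a b : Fin n), ∑ k, S ω k a * S ω k b = ∑ k, S ω k b * S ω k a :=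
    fun ω a b => Finset.sum_congr rfl fun k _ => mul_comm _ _
  by_cases hj : j = j'
  · subst hj
    by_cases hl : l = l'
    · subst hl
      rw [hS.integral_gram_sq hm h]; simp [h]
    · simp only [hcomm _ j l]
      rw [hS.integral_gram_mul_eq_zero hm h.symm h.symm hl]
      simp [hl, h.symm]
  · by_cases hj' : j = l'
    · subst hj'
      by_cases hl : l = j'
      · subst hl
        simp only [hcomm _ l j]
        rw [hS.integral_gram_sq hm h]; simp [h]
      · simp only [hcomm _ j l]
        rw [hS.integral_gram_mul_eq_zero hm h.symm hl h.symm]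
        simp [hl, hj]
    · rw [hS.integral_gram_mul_eq_zero hm h hj hj']
      simp [hj, hj']

/-- Columns have unit norm almost surely, so the diagonal part of the double sum is exactly `u ⬝ᵥ
v`. -/
theorem ae_sketch_dotProduct [IsProbabilityMeasure μ] (hS : IsCountSketch μ S) (hm : 0 < m)
    (u v : Fin n → ℝ) :
    ∀ᵐ ω ∂μ, (S ω *ᵥ u) ⬝ᵥ (S ω *ᵥ v) - u ⬝ᵥ v =
      ∑ x ∈ (Finset.univ : Finset (Fin n × Fin n)).filter (fun x => x.1 ≠ x.2),
        u x.1 * v x.2 * ∑ k, S ω k x.1 * S ω k x.2 := by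
  filter_upwards [hS.ae_entry hm] with ω h
  have h1 : (S ω *ᵥ u) ⬝ᵥ (S ω *ᵥ v) =
      ∑ x : Fin n × Fin n, u x.1 * v x.2 * ∑ k, S ω k x.1 * S ω k x.2 := by
    simp only [dotProduct, mulVec, Fintype.sum_prod_type, Finset.sum_mul_sum]
    rw [Finset.sum_comm]
    refine Finset.sum_congr rfl fun j _ => ?_
    rw [Finset.sum_comm]
    refine Finset.sum_congr rfl fun l _ => ?_
    rw [Finset.mul_sum]
    exact Finset.sum_congr rfl fun k _ => by ring
  rw [h1, ← Finset.sum_filter_add_sum_filter_not Finset.univ (fun x : Fin n × Fin n => x.1 ≠ x.2)]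
  have h2 : ∑ x ∈ (Finset.univ : Finset (Fin n × Fin n)).filter (fun x => ¬ x.1 ≠ x.2),
      u x.1 * v x.2 * ∑ k, S ω k x.1 * S ω k x.2 = u ⬝ᵥ v := by
    rw [Finset.sum_filter, Fintype.sum_prod_type]
    simp [h.2.1, dotProduct]
  rw [h2]; ring

theorem ae_sketch_dotProduct_sq [IsProbabilityMeasure μ] (hS : IsCountSketch μ S) (hm : 0 < m)
    (u v : Fin n → ℝ) :
    (fun ω => ((S ω *ᵥ u) ⬝ᵥ (S ω *ᵥ v) - u ⬝ᵥ v) ^ 2) =ᵐ[μ] fun ω =>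
      ∑ x ∈ (Finset.univ : Finset (Fin n × Fin n)).filter (fun x => x.1 ≠ x.2),
      ∑ y ∈ (Finset.univ : Finset (Fin n × Fin n)).filter (fun x => x.1 ≠ x.2),
        (u x.1 * v x.2 * (u y.1 * v y.2)) *
          ((∑ k, S ω k x.1 * S ω k x.2) * ∑ k, S ω k y.1 * S ω k y.2) := by
  filter_upwards [hS.ae_sketch_dotProduct hm u v] with ω h
  rw [h, sq, Finset.sum_mul_sum]
  exact Finset.sum_congr rfl fun k _ => Finset.sum_congr rfl fun k' _ => by ring

theorem integrable_sketch_dotProduct_sq [IsProbabilityMeasure μ] (hS : IsCountSketch μ S)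
    (hm : 0 < m) (u v : Fin n → ℝ) :
    Integrable (fun ω => ((S ω *ᵥ u) ⬝ᵥ (S ω *ᵥ v) - u ⬝ᵥ v) ^ 2) μ := by
  have := hS.ae_sketch_dotProduct_sq hm u v
  rw [integrable_congr this]
  exact integrable_finsetSum _ fun x _ => integrable_finsetSum _ fun y _ =>
    (hS.integrable_gram_mul hm _ _ _ _).const_mul _

/-- The approximate matrix multiplication bound of a countsketch, for a pair of vectors. -/
theorem integral_sketch_dotProduct_sq_le [IsProbabilityMeasure μ] (hS : IsCountSketch μ S)
    (hm : 0 < m) (u v : Fin n → ℝ) :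
    ∫ ω, ((S ω *ᵥ u) ⬝ᵥ (S ω *ᵥ v) - u ⬝ᵥ v) ^ 2 ∂μ ≤
      ((u ⬝ᵥ u) * (v ⬝ᵥ v) + (u ⬝ᵥ v) ^ 2) / m := by
  have := hS.ae_sketch_dotProduct_sq hm u v
  rw [integral_congr_ae this, integral_finsetSum _ fun x _ => integrable_finsetSum _ fun y _ =>
    (hS.integrable_gram_mul hm _ _ _ _).const_mul _]
  simp only [integral_finsetSum _ fun y _ => (hS.integrable_gram_mul hm _ _ _ _).const_mul _,
    integral_const_mul]
  have hx : ∀ x ∈ (Finset.univ : Finset (Fin n × Fin n)).filter (fun x => x.1 ≠ x.2),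
      ∑ y ∈ (Finset.univ : Finset (Fin n × Fin n)).filter (fun x => x.1 ≠ x.2),
        (u x.1 * v x.2 * (u y.1 * v y.2)) *
          ∫ ω, (∑ k, S ω k x.1 * S ω k x.2) * (∑ k, S ω k y.1 * S ω k y.2) ∂μ =
      (u x.1 * u x.1 * (v x.2 * v x.2) + u x.1 * v x.1 * (u x.2 * v x.2)) / m := by
    -- For fixed `(a, b)` only the pairs `(a, b)` and `(b, a)` correlate with it.
    rintro ⟨a, b⟩ hab
    have hab' : a ≠ b := by simpa using hab
    have : ∀ y ∈ (Finset.univ : Finset (Fin n × Fin n)).filter (fun x => x.1 ≠ x.2),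
        (u a * v b * (u y.1 * v y.2)) *
          ∫ ω, (∑ k, S ω k a * S ω k b) * (∑ k, S ω k y.1 * S ω k y.2) ∂μ =
        (if y = (a, b) then u a * v b * (u a * v b) / m else 0) +
          (if y = (b, a) then u a * v b * (u b * v a) / m else 0) := by
      rintro ⟨c, d⟩ hcd
      rw [hS.integral_gram_mul hm hab' (by simpa using hcd)]
      simp only [Prod.mk.injEq]
      by_cases h1 : c = a ∧ d = b
      · obtain ⟨rfl, rfl⟩ := h1
        simp [hab']
        ring
      · by_cases h2 : c = b ∧ d = a
        · obtain ⟨rfl, rfl⟩ := h2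
          simp [hab']
          ring
        · have h3 : ¬ (a = c ∧ b = d) := fun h => h1 ⟨h.1.symm, h.2.symm⟩
          have h4 : ¬ (a = d ∧ b = c) := fun h => h2 ⟨h.2.symm, h.1.symm⟩
          simp [h1, h2, h3, h4]
    rw [Finset.sum_congr rfl this, Finset.sum_add_distrib, Finset.sum_ite_eq', Finset.sum_ite_eq']
    simp [hab', hab'.symm]
    ring
  rw [Finset.sum_congr rfl hx, ← Finset.sum_div]
  refine div_le_div_of_nonneg_right ?_ (by positivity)
  have htot : (u ⬝ᵥ u) * (v ⬝ᵥ v) + (u ⬝ᵥ v) ^ 2 = ∑ x : Fin n × Fin n,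
      (u x.1 * u x.1 * (v x.2 * v x.2) + u x.1 * v x.1 * (u x.2 * v x.2)) := by
    simp only [dotProduct, sq, Finset.sum_mul_sum, Finset.sum_add_distrib,
      Fintype.sum_prod_type]
  rw [htot, ← Finset.sum_filter_add_sum_filter_not Finset.univ
    (fun x : Fin n × Fin n => x.1 ≠ x.2)]
  -- The missing diagonal terms are `2(u a * v a)²`, so including them only enlarges the bound.
  refine le_add_of_nonneg_right (Finset.sum_nonneg ?_)
  rintro ⟨a, b⟩ hab
  obtain rfl : a = b := by simpa using hab
  simp only
  nlinarith [mul_self_nonneg (u a * v a)]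

end IsCountSketch

/-! ### Euclidean norms and smallest singular values. -/

theorem euclNorm_nonneg {k : ℕ} (v : Fin k → ℝ) : 0 ≤ euclNorm v := norm_nonneg _

theorem euclNorm_sq {k : ℕ} (v : Fin k → ℝ) : euclNorm v ^ 2 = v ⬝ᵥ v := by
  rw [euclNorm, EuclideanSpace.real_norm_sq_eq]
  simp [dotProduct, sq]

theorem euclNorm_add_le {k : ℕ} (v w : Fin k → ℝ) :
    euclNorm (v + w) ≤ euclNorm v + euclNorm w := by
  simp only [euclNorm, WithLp.toLp_add]
  exact norm_add_le _ _

theorem euclNorm_neg {k : ℕ} (v : Fin k → ℝ) : euclNorm (-v) = euclNorm v := by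
  simp [euclNorm]

theorem euclNorm_eq_zero {k : ℕ} {v : Fin k → ℝ} : euclNorm v = 0 ↔ v = 0 := by
  simp [euclNorm]

theorem dotProduct_le_euclNorm_mul {k : ℕ} (v w : Fin k → ℝ) :
    v ⬝ᵥ w ≤ euclNorm v * euclNorm w := by
  have := Finset.sum_mul_sq_le_sq_mul_sq Finset.univ v w
  refine le_of_sq_le_sq ?_ (mul_nonneg (euclNorm_nonneg _) (euclNorm_nonneg _))
  rw [mul_pow, euclNorm_sq, euclNorm_sq]
  simpa [dotProduct, sq] using this

theorem euclNorm_mulVec_of_orthonormal {n k : ℕ} {U : Matrix (Fin n) (Fin k) ℝ} (hU : Uᵀ * U = 1)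
    (v : Fin k → ℝ) : euclNorm (U *ᵥ v) = euclNorm v := by
  rw [← sq_eq_sq₀ (euclNorm_nonneg _) (euclNorm_nonneg _), euclNorm_sq, euclNorm_sq,
    dotProduct_mulVec, vecMul_mulVec, hU, ← mulVec_transpose]
  simp

theorem euclNorm_transpose_mulVec_le_of_orthonormal {n k : ℕ} {U : Matrix (Fin n) (Fin k) ℝ}
    (hU : Uᵀ * U = 1) (v : Fin n → ℝ) : euclNorm (Uᵀ *ᵥ v) ≤ euclNorm v := by
  have h1 : euclNorm (Uᵀ *ᵥ v) ^ 2 ≤ euclNorm (Uᵀ *ᵥ v) * euclNorm v := by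
    rw [euclNorm_sq, dotProduct_comm, dotProduct_mulVec, vecMul_transpose]
    refine (dotProduct_le_euclNorm_mul _ _).trans_eq ?_
    rw [euclNorm_mulVec_of_orthonormal hU]
  nlinarith [euclNorm_nonneg (Uᵀ *ᵥ v), euclNorm_nonneg v]

/-- Cauchy–Schwarz row by row: the Frobenius norm dominates the operator norm. -/
theorem euclNorm_mulVec_le_of_sum_sq_le {k l : ℕ} {A : Matrix (Fin k) (Fin l) ℝ} {a : ℝ}
    (ha : 0 ≤ a) (hA : ∑ i, ∑ j, A i j ^ 2 ≤ a ^ 2) (v : Fin l → ℝ) :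
    euclNorm (A *ᵥ v) ≤ a * euclNorm v := by
  refine le_of_sq_le_sq ?_ (mul_nonneg ha (euclNorm_nonneg _))
  calc euclNorm (A *ᵥ v) ^ 2 = ∑ i, (∑ j, A i j * v j) ^ 2 := by
        rw [euclNorm_sq]; simp [dotProduct, mulVec, sq]
    _ ≤ ∑ i, (∑ j, A i j ^ 2) * ∑ j, v j ^ 2 :=
        Finset.sum_le_sum fun i _ => Finset.sum_mul_sq_le_sq_mul_sq _ _ _
    _ = (∑ i, ∑ j, A i j ^ 2) * euclNorm v ^ 2 := by
        rw [← Finset.sum_mul, euclNorm_sq]; simp [dotProduct, sq]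
    _ ≤ (a * euclNorm v) ^ 2 := by
        rw [mul_pow]; gcongr

theorem euclNorm_transpose_mulVec_le_of_sum_sq_le {k l : ℕ} {A : Matrix (Fin k) (Fin l) ℝ} {a : ℝ}
    (ha : 0 ≤ a) (hA : ∑ i, ∑ j, A i j ^ 2 ≤ a ^ 2) (v : Fin k → ℝ) :
    euclNorm (Aᵀ *ᵥ v) ≤ a * euclNorm v := by
  refine euclNorm_mulVec_le_of_sum_sq_le ha ?_ v
  rw [Finset.sum_comm]
  exact hA

theorem sigmaMin_nonneg {a b : ℕ} (A : Matrix (Fin a) (Fin b) ℝ) : 0 ≤ sigmaMin A :=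
  LinearMap.singularValues_nonneg _ _

/-- Expand in an eigenbasis of `AᵀA`. The condition `b ≤ a` makes `min a b - 1` the last index `b -
1`; for a wide matrix the kernel would defeat the bound. -/
theorem sigmaMin_mul_euclNorm_le {a b : ℕ} (hab : b ≤ a) (A : Matrix (Fin a) (Fin b) ℝ)
    (v : Fin b → ℝ) : sigmaMin A * euclNorm v ≤ euclNorm (A *ᵥ v) := by
  rcases Nat.eq_zero_or_pos b with rfl | hb
  · have : euclNorm v = 0 := euclNorm_eq_zero.2 (Subsingleton.elim _ _)
    rw [this, mul_zero]; exact euclNorm_nonneg _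
  set T := Matrix.toEuclideanLin A with hT
  have hfin : Module.finrank ℝ (EuclideanSpace ℝ (Fin b)) = b := by simp
  have hs := T.isSymmetric_adjoint_comp_self
  set x : EuclideanSpace ℝ (Fin b) := WithLp.toLp 2 v with hx
  set B := hs.eigenvectorBasis hfin with hB
  have hle : ∀ i, sigmaMin A ^ 2 ≤ hs.eigenvalues hfin i := by
    intro i
    rw [← T.sq_singularValues_fin hfin i]
    refine pow_le_pow_left₀ (sigmaMin_nonneg A) ?_ 2
    refine T.singularValues_antitone ?_
    rw [min_eq_right hab]
    omega
  have hnorm : ‖T x‖ ^ 2 = ∑ i, hs.eigenvalues hfin i * (inner ℝ (B i) x) ^ 2 := by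
    have h1 : ‖T x‖ ^ 2 = inner ℝ x ((LinearMap.adjoint T ∘ₗ T) x) := by
      rw [LinearMap.comp_apply, LinearMap.adjoint_inner_right, real_inner_self_eq_norm_sq]
    rw [h1, ← B.sum_inner_mul_inner]
    refine Finset.sum_congr rfl fun i _ => ?_
    rw [← hs (B i) x, hB, hs.apply_eigenvectorBasis hfin i, real_inner_comm, inner_smul_left]
    simp
    ring
  have hx2 : ‖x‖ ^ 2 = ∑ i, (inner ℝ (B i) x) ^ 2 := by
    rw [← B.sum_sq_norm_inner_right x]
    simp
  have hmain : (sigmaMin A * ‖x‖) ^ 2 ≤ ‖T x‖ ^ 2 := by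
    rw [mul_pow, hnorm, hx2, Finset.mul_sum]
    exact Finset.sum_le_sum fun i _ => mul_le_mul_of_nonneg_right (hle i) (sq_nonneg _)
  have := le_of_sq_le_sq hmain (norm_nonneg _)
  simpa [euclNorm, hT, hx, Matrix.toLpLin_toLp] using this

theorem sigmaMin_pos {a b : ℕ} (hab : b ≤ a) (hb : 0 < b) {A : Matrix (Fin a) (Fin b) ℝ}
    (hA : ∀ v, A *ᵥ v = 0 → v = 0) : 0 < sigmaMin A := by
  have hinj : Function.Injective (Matrix.toEuclideanLin A) := by
    rw [injective_iff_map_eq_zero]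
    intro x hx
    have h1 : A *ᵥ x.ofLp = 0 := by
      have := congrArg WithLp.ofLp hx
      simpa using this
    exact WithLp.ofLp_injective 2 (hA _ h1)
  refine (LinearMap.injective_iff_forall_lt_finrank_singularValues_pos _).1 hinj _ ?_
  simp
  omega

theorem isUnit_of_mulVec_eq_zero {k : ℕ} {A : Matrix (Fin k) (Fin k) ℝ}
    (hA : ∀ v, A *ᵥ v = 0 → v = 0) : IsUnit A := by
  rw [← Matrix.mulVec_injective_iff_isUnit]
  intro v w h
  have := hA (v - w) (by rw [mulVec_sub]; exact sub_eq_zero.2 h)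
  exact sub_eq_zero.1 this

/-! ### Coercivity of the perturbed quadratic form. -/

section Perturbation

variable {q p : ℕ} {G : Matrix (Fin q) (Fin q) ℝ} {a : ℝ}

theorem euclNorm_mulVec_bounds (ha : 0 ≤ a) (hG : ∑ i, ∑ j, (G - 1) i j ^ 2 ≤ a ^ 2)
    (z : Fin q → ℝ) : (1 - a) * euclNorm z ≤ euclNorm (G *ᵥ z) ∧
      euclNorm (G *ᵥ z) ≤ (1 + a) * euclNorm z ∧
      (1 - a) * euclNorm z ^ 2 ≤ (G *ᵥ z) ⬝ᵥ z := by
  have h := euclNorm_mulVec_le_of_sum_sq_le ha hG z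
  have hd : G *ᵥ z = z + (G - 1) *ᵥ z := by rw [sub_mulVec, one_mulVec]; abel
  have hd' : z = G *ᵥ z + -((G - 1) *ᵥ z) := by rw [sub_mulVec, one_mulVec]; abel
  refine ⟨?_, ?_, ?_⟩
  · have := euclNorm_add_le (G *ᵥ z) (-((G - 1) *ᵥ z))
    rw [← hd', euclNorm_neg] at this
    linarith
  · have := euclNorm_add_le z ((G - 1) *ᵥ z)
    rw [← hd] at this
    linarith
  · have h1 := dotProduct_le_euclNorm_mul (-((G - 1) *ᵥ z)) z
    rw [euclNorm_neg, neg_dotProduct] at h1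
    have h2 := mul_le_mul_of_nonneg_right h (euclNorm_nonneg z)
    have h3 : (G *ᵥ z) ⬝ᵥ z = euclNorm z ^ 2 + ((G - 1) *ᵥ z) ⬝ᵥ z := by
      rw [euclNorm_sq, ← add_dotProduct, ← hd]
    nlinarith

theorem isUnit_of_sum_sq_sub_one_le (ha : 0 ≤ a) (ha' : a < 1)
    (hG : ∑ i, ∑ j, (G - 1) i j ^ 2 ≤ a ^ 2) : IsUnit G := by
  refine isUnit_of_mulVec_eq_zero fun v hv => ?_
  have := (euclNorm_mulVec_bounds ha hG v).1
  rw [hv, euclNorm_eq_zero.2 rfl] at this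
  exact euclNorm_eq_zero.1 (le_antisymm (by nlinarith [euclNorm_nonneg v]) (euclNorm_nonneg v))

variable {W W' : Matrix (Fin q) (Fin p) ℝ} {s : ℝ}

theorem sq_mul_euclNorm_le_quadratic (ha : 0 ≤ a) (ha' : a ≤ 1 / 8) (has : a ≤ s / 8)
    (hG : ∑ i, ∑ j, (G - 1) i j ^ 2 ≤ a ^ 2) (hW : ∑ i, ∑ j, (W' - W) i j ^ 2 ≤ a ^ 2)
    (hlow : ∀ v, s * euclNorm v ≤ euclNorm (W *ᵥ v)) (w : Fin p → ℝ) :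
    s ^ 2 * euclNorm w ^ 2 ≤ 2 * (w ⬝ᵥ ((W'ᵀ * G⁻¹ * W') *ᵥ w)) := by
  have hu := isUnit_of_sum_sq_sub_one_le ha (by linarith) hG
  set x := W' *ᵥ w with hx
  set z := G⁻¹ *ᵥ x with hz
  have hGz : G *ᵥ z = x := by
    rw [hz, mulVec_mulVec, mul_nonsing_inv _ ((isUnit_iff_isUnit_det _).1 hu), one_mulVec]
  -- Passing to `z = G⁻¹ W' w` turns the form into `Gz · z`, so no estimate of `G⁻¹` as an operator
  -- is needed.
  have hquad : w ⬝ᵥ ((W'ᵀ * G⁻¹ * W') *ᵥ w) = (G *ᵥ z) ⬝ᵥ z := by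
    rw [hGz, hz, hx, ← mulVec_mulVec, ← mulVec_mulVec, dotProduct_mulVec, vecMul_transpose]
  obtain ⟨h1, h2, h3⟩ := euclNorm_mulVec_bounds ha hG z
  rw [hquad]
  refine le_trans ?_ (mul_le_mul_of_nonneg_left h3 zero_le_two)
  rw [hGz] at h2
  have hxlow : 7 / 8 * (s * euclNorm w) ≤ euclNorm x := by
    have e1 := euclNorm_mulVec_le_of_sum_sq_le ha hW w
    have e2 := euclNorm_add_le x (-((W' - W) *ᵥ w))
    have e3 : x + -((W' - W) *ᵥ w) = W *ᵥ w := by rw [hx, sub_mulVec]; abel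
    rw [e3, euclNorm_neg] at e2
    have e4 := hlow w
    have e5 := mul_le_mul_of_nonneg_right has (euclNorm_nonneg w)
    linarith
  have hs : 0 ≤ s := by linarith
  have hzn := euclNorm_nonneg z
  have hzlow : 7 / 9 * (s * euclNorm w) ≤ euclNorm z := by
    have : (1 + a) * euclNorm z ≤ 9 / 8 * euclNorm z := by gcongr; linarith
    linarith
  have hsw : 0 ≤ s * euclNorm w := mul_nonneg hs (euclNorm_nonneg w)
  have h5 : (7 / 9 * (s * euclNorm w)) ^ 2 ≤ euclNorm z ^ 2 := by gcongr
  have h6 : 7 / 8 * euclNorm z ^ 2 ≤ (1 - a) * euclNorm z ^ 2 := by gcongr; linarith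
  -- The constants close because `2 · (7/8) · (7/9)² = 343/324 ≥ 1`.
  nlinarith [sq_nonneg (s * euclNorm w)]

theorem isUnit_quadratic (ha : 0 ≤ a) (ha' : a ≤ 1 / 8) (has : a ≤ s / 8) (hs : 0 < s)
    (hG : ∑ i, ∑ j, (G - 1) i j ^ 2 ≤ a ^ 2) (hW : ∑ i, ∑ j, (W' - W) i j ^ 2 ≤ a ^ 2)
    (hlow : ∀ v, s * euclNorm v ≤ euclNorm (W *ᵥ v)) : IsUnit (W'ᵀ * G⁻¹ * W') := by
  refine isUnit_of_mulVec_eq_zero fun v hv => ?_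
  have := sq_mul_euclNorm_le_quadratic ha ha' has hG hW hlow v
  rw [hv, dotProduct_zero, mul_zero] at this
  have h2 : euclNorm v ^ 2 ≤ 0 := by
    by_contra hc
    have := mul_pos (pow_pos hs 2) (not_le.1 hc)
    linarith
  exact euclNorm_eq_zero.1 (pow_eq_zero_iff two_ne_zero |>.1 (le_antisymm h2 (sq_nonneg _)))

/-- Pair the equation with `w`, use coercivity and Cauchy–Schwarz, and cancel one factor `euclNorm
w`. The constant is `2 · (9/8) · (8/7) = 18/7`. -/
theorem sq_mul_euclNorm_le_of_quadratic_eq (ha : 0 ≤ a) (ha' : a ≤ 1 / 8) (has : a ≤ s / 8)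
    (hG : ∑ i, ∑ j, (G - 1) i j ^ 2 ≤ a ^ 2) (hW : ∑ i, ∑ j, (W' - W) i j ^ 2 ≤ a ^ 2)
    (hlow : ∀ v, s * euclNorm v ≤ euclNorm (W *ᵥ v))
    (hup : ∀ v, euclNorm (Wᵀ *ᵥ v) ≤ euclNorm v)
    {w θ : Fin p → ℝ} {ρ : Fin q → ℝ}
    (h : (W'ᵀ * G⁻¹ * W') *ᵥ w = θ + W'ᵀ *ᵥ (G⁻¹ *ᵥ ρ)) :
    s ^ 2 * euclNorm w ≤ 18 / 7 * (euclNorm θ + euclNorm ρ) := by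
  have hu := isUnit_of_sum_sq_sub_one_le ha (by linarith) hG
  have hρ : euclNorm (G⁻¹ *ᵥ ρ) ≤ 8 / 7 * euclNorm ρ := by
    have := (euclNorm_mulVec_bounds ha hG (G⁻¹ *ᵥ ρ)).1
    rw [mulVec_mulVec, mul_nonsing_inv _ ((isUnit_iff_isUnit_det _).1 hu), one_mulVec] at this
    have h2 : 7 / 8 * euclNorm (G⁻¹ *ᵥ ρ) ≤ (1 - a) * euclNorm (G⁻¹ *ᵥ ρ) :=
      mul_le_mul_of_nonneg_right (by linarith) (euclNorm_nonneg _)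
    linarith
  have hW' : ∀ v, euclNorm (W'ᵀ *ᵥ v) ≤ 9 / 8 * euclNorm v := by
    intro v
    have e1 := euclNorm_transpose_mulVec_le_of_sum_sq_le ha hW v
    have e2 := euclNorm_add_le (Wᵀ *ᵥ v) ((W' - W)ᵀ *ᵥ v)
    have e3 : Wᵀ *ᵥ v + (W' - W)ᵀ *ᵥ v = W'ᵀ *ᵥ v := by rw [← add_mulVec]; simp
    rw [e3] at e2
    have e4 := mul_le_mul_of_nonneg_right ha' (euclNorm_nonneg v)
    linarith [hup v]
  have hrhs : euclNorm (θ + W'ᵀ *ᵥ (G⁻¹ *ᵥ ρ)) ≤ 9 / 7 * (euclNorm θ + euclNorm ρ) := by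
    have := euclNorm_add_le θ (W'ᵀ *ᵥ (G⁻¹ *ᵥ ρ))
    linarith [hW' (G⁻¹ *ᵥ ρ), euclNorm_nonneg θ]
  have hq := sq_mul_euclNorm_le_quadratic ha ha' has hG hW hlow w
  rw [h] at hq
  have hc := dotProduct_le_euclNorm_mul w (θ + W'ᵀ *ᵥ (G⁻¹ *ᵥ ρ))
  have hm := mul_le_mul_of_nonneg_left hrhs (euclNorm_nonneg w)
  rcases (euclNorm_nonneg w).eq_or_lt with h0 | h0
  · rw [← h0, mul_zero]
    have := euclNorm_nonneg θ
    have := euclNorm_nonneg ρ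
    positivity
  · refine le_of_mul_le_mul_left ?_ h0
    nlinarith

end Perturbation

/-! ### Reduction to orthonormal factors and the deterministic error bound. -/

theorem IsThinSVD.exists_eq_mul {n k : ℕ} {A U : Matrix (Fin n) (Fin k) ℝ} {σ : Fin k → ℝ}
    {V : Matrix (Fin k) (Fin k) ℝ} (h : IsThinSVD A U σ V) :
    ∃ D : Matrix (Fin k) (Fin k) ℝ, A = U * D :=
  ⟨diagonal σ * Vᵀ, by rw [h.eq, Matrix.mul_assoc]⟩

theorem projMatrix_mul_of_isUnit {n q : ℕ} (U : Matrix (Fin n) (Fin q) ℝ)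
    {D : Matrix (Fin q) (Fin q) ℝ} (hD : IsUnit D) : projMatrix (U * D) = projMatrix U := by
  have hd := (isUnit_iff_isUnit_det _).1 hD
  have hdt : IsUnit Dᵀ.det := by rwa [det_transpose]
  unfold projMatrix
  have h1 : (U * D)ᵀ * (U * D) = Dᵀ * ((Uᵀ * U) * D) := by
    rw [transpose_mul]; simp only [Matrix.mul_assoc]
  rw [h1, Matrix.mul_inv_rev, Matrix.mul_inv_rev, transpose_mul]
  calc U * D * (D⁻¹ * (Uᵀ * U)⁻¹ * Dᵀ⁻¹) * (Dᵀ * Uᵀ)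
      = U * (D * D⁻¹) * (Uᵀ * U)⁻¹ * (Dᵀ⁻¹ * Dᵀ) * Uᵀ := by simp only [Matrix.mul_assoc]
    _ = _ := by rw [mul_nonsing_inv _ hd, nonsing_inv_mul _ hdt, Matrix.mul_one, Matrix.mul_one]

theorem isUnit_of_isUnit_mul_right {k : ℕ} {A B : Matrix (Fin k) (Fin k) ℝ} (h : IsUnit (A * B)) :
    IsUnit B := by
  rw [isUnit_iff_isUnit_det, det_mul] at h
  exact (isUnit_iff_isUnit_det _).2 (isUnit_of_mul_isUnit_right h)

theorem le_of_mulVec_eq_zero {a b : ℕ} {A : Matrix (Fin a) (Fin b) ℝ}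
    (hA : ∀ v, A *ᵥ v = 0 → v = 0) : b ≤ a := by
  have hinj : Function.Injective A.mulVecLin := by
    rw [injective_iff_map_eq_zero]
    exact hA
  simpa using LinearMap.finrank_le_finrank_of_injective hinj

/-- The normal equations of two-stage least squares. -/
theorem twoSLS_normal_equations {n p q : ℕ} {X : Matrix (Fin n) (Fin p) ℝ}
    {Z : Matrix (Fin n) (Fin q) ℝ} (hX : IsUnit (Xᵀ * projMatrix Z * X)) (y : Fin n → ℝ) :
    (Xᵀ * projMatrix Z) *ᵥ twoSLSResidual X Z y = 0 := by
  rw [twoSLSResidual, mulVec_sub, mulVec_mulVec, twoSLS, mulVec_mulVec,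
    mul_nonsing_inv _ ((isUnit_iff_isUnit_det _).1 hX), one_mulVec, mulVec_mulVec, sub_self]

theorem mulVec_twoSLS_sub {m p q : ℕ} {X : Matrix (Fin m) (Fin p) ℝ}
    {Z : Matrix (Fin m) (Fin q) ℝ} (hX : IsUnit (Xᵀ * projMatrix Z * X)) (y : Fin m → ℝ)
    (β : Fin p → ℝ) :
    (Xᵀ * projMatrix Z * X) *ᵥ (twoSLS X Z y - β) = (Xᵀ * projMatrix Z) *ᵥ (y - X *ᵥ β) := by
  rw [mulVec_sub, twoSLS, mulVec_mulVec, mul_nonsing_inv _ ((isUnit_iff_isUnit_det _).1 hX),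
    one_mulVec, mulVec_mulVec, mulVec_sub, mulVec_mulVec]

section Sketch

variable {n p q m : ℕ} {UX : Matrix (Fin n) (Fin p) ℝ} {UZ : Matrix (Fin n) (Fin q) ℝ}
  {E : Matrix (Fin p) (Fin p) ℝ} {D : Matrix (Fin q) (Fin q) ℝ}

theorem projMatrix_of_orthonormal (hUZ : UZᵀ * UZ = 1) : projMatrix UZ = UZ * UZᵀ := by
  simp [projMatrix, hUZ]

/-- This orthogonality makes the first noise term a sketch of a zero product. -/
theorem normal_equations_factored (hUZ : UZᵀ * UZ = 1) (hD : IsUnit D)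
    (hX : IsUnit ((UX * E)ᵀ * projMatrix (UZ * D) * (UX * E))) (y : Fin n → ℝ) :
    UXᵀ *ᵥ (UZ *ᵥ (UZᵀ *ᵥ twoSLSResidual (UX * E) (UZ * D) y)) = 0 := by
  have hE : IsUnit E := by
    rw [← Matrix.mul_assoc] at hX
    exact isUnit_of_isUnit_mul_right hX
  have h := twoSLS_normal_equations hX y
  rw [projMatrix_mul_of_isUnit _ hD, projMatrix_of_orthonormal hUZ, transpose_mul,
    Matrix.mul_assoc, ← mulVec_mulVec] at h
  have hEt : IsUnit Eᵀ := by rwa [isUnit_transpose]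
  have h2 := (Matrix.mulVec_injective_iff_isUnit.2 hEt) (h.trans (mulVec_zero Eᵀ).symm)
  rwa [← mulVec_mulVec, ← mulVec_mulVec] at h2

theorem transpose_mul_mulVec_eq_zero (hUZ : UZᵀ * UZ = 1) (hD : IsUnit D)
    (hX : IsUnit ((UX * E)ᵀ * projMatrix (UZ * D) * (UX * E))) (v : Fin p → ℝ)
    (hv : (UZᵀ * UX) *ᵥ v = 0) : v = 0 := by
  have hM : IsUnit (UXᵀ * projMatrix (UZ * D) * UX) := by
    have : (UX * E)ᵀ * projMatrix (UZ * D) * (UX * E) =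
        Eᵀ * (UXᵀ * projMatrix (UZ * D) * UX * E) := by
      rw [transpose_mul]; simp only [Matrix.mul_assoc]
    rw [this] at hX
    have h1 := isUnit_of_isUnit_mul_right hX
    rw [isUnit_iff_isUnit_det, det_mul] at h1
    exact (isUnit_iff_isUnit_det _).2 (isUnit_of_mul_isUnit_left h1)
  refine Matrix.mulVec_injective_iff_isUnit.2 hM ?_
  rw [mulVec_zero, projMatrix_mul_of_isUnit _ hD, projMatrix_of_orthonormal hUZ]
  calc (UXᵀ * (UZ * UZᵀ) * UX) *ᵥ v = (UXᵀ * UZ) *ᵥ ((UZᵀ * UX) *ᵥ v) := by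
        rw [mulVec_mulVec]; simp only [Matrix.mul_assoc]
    _ = 0 := by rw [hv, mulVec_zero]

/-- The deterministic error bound for sketched two-stage least squares. -/
theorem twoSLS_sketch_error (hUX : UXᵀ * UX = 1) (hUZ : UZᵀ * UZ = 1)
    (hD : IsUnit D) (hX : IsUnit ((UX * E)ᵀ * projMatrix (UZ * D) * (UX * E)))
    (y : Fin n → ℝ) (S : Matrix (Fin m) (Fin n) ℝ) {a : ℝ} (ha : 0 < a) (ha' : a ≤ 1 / 8)
    (has : a ≤ sigmaMin (UZᵀ * UX) / 8)
    (hG : ∑ i, ∑ j, ((S * UZ)ᵀ * (S * UZ) - 1 : Matrix (Fin q) (Fin q) ℝ) i j ^ 2 ≤ a ^ 2)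
    (hW : ∑ i, ∑ j, ((S * UZ)ᵀ * (S * UX) - UZᵀ * UX) i j ^ 2 ≤ a ^ 2)
    (e : Fin n → ℝ) (he : e = twoSLSResidual (UX * E) (UZ * D) y) :
    IsUnit ((S * (UZ * D))ᵀ * (S * (UZ * D))) ∧
    IsUnit ((S * (UX * E))ᵀ * projMatrix (S * (UZ * D)) * (S * (UX * E))) ∧
    sigmaMin (UZᵀ * UX) ^ 2 * (sigmaMin (UX * E) *
      euclNorm (twoSLS (S * (UX * E)) (S * (UZ * D)) (S *ᵥ y) - twoSLS (UX * E) (UZ * D) y)) ≤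
    18 / 7 * (euclNorm ((S * UX)ᵀ *ᵥ (S *ᵥ (UZ *ᵥ (UZᵀ *ᵥ e)))) +
      euclNorm ((S * UZ)ᵀ *ᵥ (S *ᵥ (e - UZ *ᵥ (UZᵀ *ᵥ e))))) := by
  have hE : IsUnit E := by
    rw [← Matrix.mul_assoc] at hX
    exact isUnit_of_isUnit_mul_right hX
  have hEt : IsUnit Eᵀ := by rwa [isUnit_transpose]
  have hDt : IsUnit Dᵀ := by rwa [isUnit_transpose]
  have hWinj := transpose_mul_mulVec_eq_zero hUZ hD hX
  have hpq := le_of_mulVec_eq_zero hWinj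
  have hUXinj : ∀ v, UX *ᵥ v = 0 → v = 0 := fun v hv => by
    rw [← euclNorm_eq_zero, ← euclNorm_mulVec_of_orthonormal hUX, hv, euclNorm_eq_zero.2 rfl]
  have hpn := le_of_mulVec_eq_zero hUXinj
  set s := sigmaMin (UZᵀ * UX) with hs
  have hs0 : 0 < s := by linarith
  have hlow : ∀ v, s * euclNorm v ≤ euclNorm ((UZᵀ * UX) *ᵥ v) :=
    fun v => sigmaMin_mul_euclNorm_le hpq _ v
  have hup : ∀ v, euclNorm ((UZᵀ * UX)ᵀ *ᵥ v) ≤ euclNorm v := fun v => by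
    rw [transpose_mul, transpose_transpose, ← mulVec_mulVec]
    refine (euclNorm_transpose_mulVec_le_of_orthonormal hUX _).trans_eq ?_
    exact euclNorm_mulVec_of_orthonormal hUZ v
  set G := (S * UZ)ᵀ * (S * UZ) with hGdef
  set W' := (S * UZ)ᵀ * (S * UX) with hWdef
  have hGu : IsUnit G := isUnit_of_sum_sq_sub_one_le ha.le (by linarith) hG
  have hMu : IsUnit (W'ᵀ * G⁻¹ * W') := isUnit_quadratic ha.le ha' has hs0 hG hW hlow
  have hWt : W'ᵀ = (S * UX)ᵀ * (S * UZ) := by rw [hWdef, transpose_mul, transpose_transpose]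
  have hZ' : projMatrix (S * (UZ * D)) = S * UZ * G⁻¹ * (S * UZ)ᵀ := by
    rw [← Matrix.mul_assoc, projMatrix_mul_of_isUnit _ hD, projMatrix]
  have hA : (S * (UX * E))ᵀ * projMatrix (S * (UZ * D)) = Eᵀ * (W'ᵀ * G⁻¹ * (S * UZ)ᵀ) := by
    rw [hZ', hWt, ← Matrix.mul_assoc S, transpose_mul _ E]; simp only [Matrix.mul_assoc]
  have hM : (S * (UX * E))ᵀ * projMatrix (S * (UZ * D)) * (S * (UX * E)) =
      Eᵀ * (W'ᵀ * G⁻¹ * W') * E := by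
    rw [hA, hWdef]; simp only [Matrix.mul_assoc]
  have hXu : IsUnit ((S * (UX * E))ᵀ * projMatrix (S * (UZ * D)) * (S * (UX * E))) := by
    rw [hM]; exact (hEt.mul hMu).mul hE
  refine ⟨?_, hXu, ?_⟩
  · have : (S * (UZ * D))ᵀ * (S * (UZ * D)) = Dᵀ * G * D := by
      rw [hGdef, ← Matrix.mul_assoc S, transpose_mul _ D]; simp only [Matrix.mul_assoc]
    rw [this]; exact (hDt.mul hGu).mul hD
  set d := twoSLS (S * (UX * E)) (S * (UZ * D)) (S *ᵥ y) - twoSLS (UX * E) (UZ * D) y with hd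
  -- The splitting below is valid for every `c`, since sketched projection fixes `S UZ c`. The
  -- choice `UZᵀe` matters only for the probabilistic bounds on the two terms.
  generalize UZᵀ *ᵥ e = c
  have hbase : (W'ᵀ * G⁻¹ * W') *ᵥ (E *ᵥ d) = (W'ᵀ * G⁻¹ * (S * UZ)ᵀ) *ᵥ (S *ᵥ e) := by
    have h := mulVec_twoSLS_sub hXu (S *ᵥ y) (twoSLS (UX * E) (UZ * D) y)
    have h2 : S *ᵥ y - (S * (UX * E)) *ᵥ twoSLS (UX * E) (UZ * D) y = S *ᵥ e := by
      rw [he, twoSLSResidual, mulVec_sub, mulVec_mulVec]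
    rw [h2, hM, hA, Matrix.mul_assoc, ← mulVec_mulVec _ Eᵀ, ← mulVec_mulVec _ _ E,
      ← mulVec_mulVec _ Eᵀ] at h
    exact Matrix.mulVec_injective_iff_isUnit.2 hEt h
  have hsplit : (W'ᵀ * G⁻¹ * W') *ᵥ (E *ᵥ d) = (S * UX)ᵀ *ᵥ (S *ᵥ (UZ *ᵥ c)) +
      W'ᵀ *ᵥ (G⁻¹ *ᵥ ((S * UZ)ᵀ *ᵥ (S *ᵥ (e - UZ *ᵥ c)))) := by
    have h1 : S *ᵥ e = S *ᵥ (UZ *ᵥ c) + S *ᵥ (e - UZ *ᵥ c) := by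
      rw [← mulVec_add]; congr 1; abel
    have h2 : (W'ᵀ * G⁻¹ * (S * UZ)ᵀ) *ᵥ (S *ᵥ (UZ *ᵥ c)) =
        (S * UX)ᵀ *ᵥ (S *ᵥ (UZ *ᵥ c)) := by
      calc (W'ᵀ * G⁻¹ * (S * UZ)ᵀ) *ᵥ (S *ᵥ (UZ *ᵥ c))
          = (W'ᵀ * (G⁻¹ * G)) *ᵥ c := by
            rw [mulVec_mulVec, mulVec_mulVec, hGdef]; simp only [Matrix.mul_assoc]
        _ = _ := by
            rw [nonsing_inv_mul _ ((isUnit_iff_isUnit_det _).1 hGu), Matrix.mul_one, hWt,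
              mulVec_mulVec, mulVec_mulVec]
            simp only [Matrix.mul_assoc]
    rw [hbase, h1, mulVec_add, h2]
    congr 1
    simp only [mulVec_mulVec, Matrix.mul_assoc]
  have hmain := sq_mul_euclNorm_le_of_quadratic_eq ha.le ha' has hG hW hlow hup hsplit
  refine le_trans ?_ hmain
  gcongr
  calc sigmaMin (UX * E) * euclNorm d ≤ euclNorm ((UX * E) *ᵥ d) :=
        sigmaMin_mul_euclNorm_le hpn _ d
    _ = euclNorm (E *ᵥ d) := by
        rw [← mulVec_mulVec, euclNorm_mulVec_of_orthonormal hUX]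

end Sketch

/-! ### Expected deviations of sketched matrix products. -/

namespace IsCountSketch

variable {Ω : Type*} [MeasurableSpace Ω] {μ : Measure Ω} [IsProbabilityMeasure μ] {m n a b : ℕ}
  {S : Ω → Matrix (Fin m) (Fin n) ℝ}

theorem col_dotProduct_col (U : Matrix (Fin n) (Fin a) ℝ) (V : Matrix (Fin n) (Fin b) ℝ)
    (i : Fin a) (j : Fin b) : (fun k => U k i) ⬝ᵥ (fun k => V k j) = (Uᵀ * V) i j := rfl

theorem integrable_sum_sq (hS : IsCountSketch μ S) (hm : 0 < m) (U : Matrix (Fin n) (Fin a) ℝ)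
    (V : Matrix (Fin n) (Fin b) ℝ) :
    Integrable (fun ω => ∑ i, ∑ j, ((S ω * U)ᵀ * (S ω * V) - Uᵀ * V) i j ^ 2) μ :=
  integrable_finsetSum _ fun i _ => integrable_finsetSum _ fun j _ =>
    hS.integrable_sketch_dotProduct_sq hm (fun k => U k i) (fun k => V k j)

theorem integral_sum_sq_le (hS : IsCountSketch μ S) (hm : 0 < m) {U : Matrix (Fin n) (Fin a) ℝ}
    {V : Matrix (Fin n) (Fin b) ℝ} (hU : Uᵀ * U = 1) (hV : Vᵀ * V = 1) :
    ∫ ω, ∑ i, ∑ j, ((S ω * U)ᵀ * (S ω * V) - Uᵀ * V) i j ^ 2 ∂μ ≤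
      (a * b + ∑ i, ∑ j, (Uᵀ * V) i j ^ 2) / m := by
  have hi : ∀ i j, Integrable (fun ω => ((S ω * U)ᵀ * (S ω * V) - Uᵀ * V) i j ^ 2) μ :=
    fun i j => hS.integrable_sketch_dotProduct_sq hm (fun k => U k i) (fun k => V k j)
  rw [integral_finsetSum _ fun i _ => integrable_finsetSum _ fun j _ => hi i j]
  have : ∀ i : Fin a, ∫ ω, ∑ j, ((S ω * U)ᵀ * (S ω * V) - Uᵀ * V) i j ^ 2 ∂μ ≤
      ∑ j, (1 + (Uᵀ * V) i j ^ 2) / m := by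
    intro i
    rw [integral_finsetSum _ fun j _ => hi i j]
    refine Finset.sum_le_sum fun j _ => ?_
    refine (hS.integral_sketch_dotProduct_sq_le hm (fun k => U k i) (fun k => V k j)).trans_eq ?_
    simp only [col_dotProduct_col, hU, hV, one_apply_eq, mul_one]
  refine (Finset.sum_le_sum fun i _ => this i).trans_eq ?_
  simp only [← Finset.sum_div, Finset.sum_add_distrib]
  simp

theorem euclNorm_sketch_gram_mulVec_sq (S : Matrix (Fin m) (Fin n) ℝ)
    (U : Matrix (Fin n) (Fin a) ℝ) (v : Fin n → ℝ) :
    euclNorm ((S * U)ᵀ *ᵥ (S *ᵥ v)) ^ 2 =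
      ∑ i, ((S *ᵥ fun k => U k i) ⬝ᵥ (S *ᵥ v)) ^ 2 := by
  rw [euclNorm_sq]
  simp only [dotProduct, ← sq]
  rfl

theorem integrable_dotProduct_sq_of_orthogonal (hS : IsCountSketch μ S) (hm : 0 < m)
    {u v : Fin n → ℝ} (huv : u ⬝ᵥ v = 0) :
    Integrable (fun ω => ((S ω *ᵥ u) ⬝ᵥ (S ω *ᵥ v)) ^ 2) μ := by
  simpa only [huv, sub_zero] using hS.integrable_sketch_dotProduct_sq hm u v

theorem integrable_mulVec_sq (hS : IsCountSketch μ S) (hm : 0 < m) {U : Matrix (Fin n) (Fin a) ℝ}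
    {v : Fin n → ℝ} (hUv : Uᵀ *ᵥ v = 0) :
    Integrable (fun ω => euclNorm ((S ω * U)ᵀ *ᵥ (S ω *ᵥ v)) ^ 2) μ := by
  simp only [euclNorm_sketch_gram_mulVec_sq]
  exact integrable_finsetSum _ fun i _ =>
    hS.integrable_dotProduct_sq_of_orthogonal hm (congrFun hUv i)

/-- Orthogonality removes both the centring and the `(u·v)²` term from the second moment bound,
column by column. -/
theorem integral_mulVec_sq_le (hS : IsCountSketch μ S) (hm : 0 < m)
    {U : Matrix (Fin n) (Fin a) ℝ} (hU : Uᵀ * U = 1) {v : Fin n → ℝ} (hUv : Uᵀ *ᵥ v = 0) :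
    ∫ ω, euclNorm ((S ω * U)ᵀ *ᵥ (S ω *ᵥ v)) ^ 2 ∂μ ≤ a * euclNorm v ^ 2 / m := by
  have h0 : ∀ i, (fun k => U k i) ⬝ᵥ v = 0 := fun i => congrFun hUv i
  have hle : ∀ i, ∫ ω, ((S ω *ᵥ fun k => U k i) ⬝ᵥ (S ω *ᵥ v)) ^ 2 ∂μ ≤ euclNorm v ^ 2 / m := by
    intro i
    have := hS.integral_sketch_dotProduct_sq_le hm (fun k => U k i) v
    rw [euclNorm_sq]
    simpa only [h0, sub_zero, col_dotProduct_col, hU, one_apply_eq, one_mul, ne_eq,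
      OfNat.ofNat_ne_zero, not_false_eq_true, zero_pow, add_zero] using this
  simp only [euclNorm_sketch_gram_mulVec_sq]
  rw [integral_finsetSum _ fun i _ => hS.integrable_dotProduct_sq_of_orthogonal hm (h0 i)]
  refine (Finset.sum_le_sum fun i _ => hle i).trans_eq ?_
  simp
  ring

end IsCountSketch

theorem sum_sq_transpose_mul_le {n a b : ℕ} {U : Matrix (Fin n) (Fin a) ℝ}
    {V : Matrix (Fin n) (Fin b) ℝ} (hU : Uᵀ * U = 1) (hV : Vᵀ * V = 1) :
    ∑ i, ∑ j, (Uᵀ * V) i j ^ 2 ≤ (a * b : ℝ) := by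
  have h : ∀ i j, (Uᵀ * V) i j ^ 2 ≤ 1 := by
    intro i j
    have h1 := Finset.sum_mul_sq_le_sq_mul_sq Finset.univ (fun k => U k i) (fun k => V k j)
    have h2 : ∑ k, U k i ^ 2 = 1 := by
      have := congrFun (congrFun hU i) i
      simpa [mul_apply, sq] using this
    have h3 : ∑ k, V k j ^ 2 = 1 := by
      have := congrFun (congrFun hV j) j
      simpa [mul_apply, sq] using this
    rw [h2, h3, mul_one] at h1
    simpa [mul_apply] using h1
  refine (Finset.sum_le_sum fun i _ => Finset.sum_le_sum fun j _ => h i j).trans_eq ?_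
  simp

/-! ### Markov's inequality and the combined deviation. -/

theorem one_sub_le_measureReal_le {Ω : Type*} [MeasurableSpace Ω] {μ : Measure Ω}
    [IsProbabilityMeasure μ] {f : Ω → ℝ} (hf : ∀ ω, 0 ≤ f ω) (hi : Integrable f μ) {t δ : ℝ}
    (ht : 0 < t) (h : ∫ ω, f ω ∂μ ≤ t * δ) : 1 - δ ≤ μ.real {ω | f ω ≤ t} := by
  have h1 := mul_meas_ge_le_integral_of_nonneg (μ := μ) (Filter.Eventually.of_forall hf) hi t
  have h2 : μ.real {ω | t ≤ f ω} ≤ δ := le_of_mul_le_mul_left (h1.trans h) ht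
  have h3 : (1 : ℝ) ≤ μ.real {ω | f ω ≤ t} + μ.real {ω | t ≤ f ω} := by
    rw [← probReal_univ (μ := μ)]
    refine le_trans (measureReal_mono ?_) (measureReal_union_le _ _)
    exact fun ω _ => le_total (f ω) t
  linarith

/-- The squared deviation of a sketch `S` from an isometry on the data that enter the error of
two-stage least squares: the left factors `UX`, `UZ` and the residual `e`, whose parts in and
orthogonal to the column space of `UZ` are weighted by `κ`. -/
noncomputable def sketchDeviation {n p q m : ℕ} (UX : Matrix (Fin n) (Fin p) ℝ)
    (UZ : Matrix (Fin n) (Fin q) ℝ) (e : Fin n → ℝ) (κ : ℝ) (S : Matrix (Fin m) (Fin n) ℝ) : ℝ :=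
  (∑ i, ∑ j, ((S * UZ)ᵀ * (S * UZ) - UZᵀ * UZ) i j ^ 2) +
  (∑ i, ∑ j, ((S * UZ)ᵀ * (S * UX) - UZᵀ * UX) i j ^ 2) +
  κ * (euclNorm ((S * UX)ᵀ *ᵥ (S *ᵥ (UZ *ᵥ (UZᵀ *ᵥ e)))) ^ 2 +
    euclNorm ((S * UZ)ᵀ *ᵥ (S *ᵥ (e - UZ *ᵥ (UZᵀ *ᵥ e)))) ^ 2)

section Deviation

variable {n p q m : ℕ} {UX : Matrix (Fin n) (Fin p) ℝ} {UZ : Matrix (Fin n) (Fin q) ℝ}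
  {e : Fin n → ℝ} {κ : ℝ}

theorem sketchDeviation_bounds (hκ : 0 ≤ κ) {S : Matrix (Fin m) (Fin n) ℝ} {t : ℝ}
    (h : sketchDeviation UX UZ e κ S ≤ t) :
    ∑ i, ∑ j, ((S * UZ)ᵀ * (S * UZ) - UZᵀ * UZ) i j ^ 2 ≤ t ∧
    ∑ i, ∑ j, ((S * UZ)ᵀ * (S * UX) - UZᵀ * UX) i j ^ 2 ≤ t ∧
    κ * (euclNorm ((S * UX)ᵀ *ᵥ (S *ᵥ (UZ *ᵥ (UZᵀ *ᵥ e)))) ^ 2 +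
      euclNorm ((S * UZ)ᵀ *ᵥ (S *ᵥ (e - UZ *ᵥ (UZᵀ *ᵥ e)))) ^ 2) ≤ t := by
  unfold sketchDeviation at h
  have h1 : 0 ≤ ∑ i, ∑ j, ((S * UZ)ᵀ * (S * UZ) - UZᵀ * UZ) i j ^ 2 :=
    Finset.sum_nonneg fun i _ => Finset.sum_nonneg fun j _ => sq_nonneg _
  have h2 : 0 ≤ ∑ i, ∑ j, ((S * UZ)ᵀ * (S * UX) - UZᵀ * UX) i j ^ 2 :=
    Finset.sum_nonneg fun i _ => Finset.sum_nonneg fun j _ => sq_nonneg _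
  have h3 : 0 ≤ κ * (euclNorm ((S * UX)ᵀ *ᵥ (S *ᵥ (UZ *ᵥ (UZᵀ *ᵥ e)))) ^ 2 +
      euclNorm ((S * UZ)ᵀ *ᵥ (S *ᵥ (e - UZ *ᵥ (UZᵀ *ᵥ e)))) ^ 2) :=
    mul_nonneg hκ (add_nonneg (sq_nonneg _) (sq_nonneg _))
  refine ⟨?_, ?_, ?_⟩ <;> linarith

theorem sketchDeviation_nonneg (hκ : 0 ≤ κ) (S : Matrix (Fin m) (Fin n) ℝ) :
    0 ≤ sketchDeviation UX UZ e κ S :=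
  (Finset.sum_nonneg fun _ _ => Finset.sum_nonneg fun _ _ => sq_nonneg _).trans
    (sketchDeviation_bounds hκ le_rfl).1

theorem transpose_mulVec_residual (hUZ : UZᵀ * UZ = 1) (e : Fin n → ℝ) :
    UZᵀ *ᵥ (e - UZ *ᵥ (UZᵀ *ᵥ e)) = 0 := by
  rw [mulVec_sub, mulVec_mulVec, hUZ, one_mulVec, sub_self]

theorem euclNorm_sq_projection_add (hUZ : UZᵀ * UZ = 1) (e : Fin n → ℝ) :
    euclNorm (UZ *ᵥ (UZᵀ *ᵥ e)) ^ 2 + euclNorm (e - UZ *ᵥ (UZᵀ *ᵥ e)) ^ 2 = euclNorm e ^ 2 := by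
  have hr := transpose_mulVec_residual hUZ e
  generalize UZᵀ *ᵥ e = c at hr ⊢
  obtain ⟨r, rfl⟩ : ∃ r, e = UZ *ᵥ c + r := ⟨e - UZ *ᵥ c, by abel⟩
  rw [add_sub_cancel_left] at hr ⊢
  have h2 : (UZ *ᵥ c) ⬝ᵥ r = 0 := by
    rw [dotProduct_comm, dotProduct_mulVec, ← mulVec_transpose, hr, zero_dotProduct]
  have h3 : r ⬝ᵥ (UZ *ᵥ c) = 0 := by rw [dotProduct_comm, h2]
  simp only [euclNorm_sq]
  rw [add_dotProduct, dotProduct_add, dotProduct_add, h2, h3]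
  ring

variable {Ω : Type*} [MeasurableSpace Ω] {μ : Measure Ω} [IsProbabilityMeasure μ]
  {S : Ω → Matrix (Fin m) (Fin n) ℝ}

theorem IsCountSketch.integrable_sketchDeviation (hS : IsCountSketch μ S) (hm : 0 < m)
    (hUZ : UZᵀ * UZ = 1) (hnormal : UXᵀ *ᵥ (UZ *ᵥ (UZᵀ *ᵥ e)) = 0) :
    Integrable (fun ω => sketchDeviation UX UZ e κ (S ω)) μ :=
  ((hS.integrable_sum_sq hm UZ UZ).add (hS.integrable_sum_sq hm UZ UX)).add
    (((hS.integrable_mulVec_sq hm hnormal).add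
      (hS.integrable_mulVec_sq hm (transpose_mulVec_residual hUZ e))).const_mul κ)

theorem IsCountSketch.integral_sketchDeviation_le (hS : IsCountSketch μ S) (hm : 0 < m)
    (hUX : UXᵀ * UX = 1) (hUZ : UZᵀ * UZ = 1) (hnormal : UXᵀ *ᵥ (UZ *ᵥ (UZᵀ *ᵥ e)) = 0)
    (hκ0 : 0 ≤ κ) (hκe : κ * euclNorm e ^ 2 ≤ p) (hpq : p ≤ q) {t : ℝ}
    (hm1 : (q : ℝ) * (q + 1) ≤ m * t) (hm2 : (2 : ℝ) * p * q ≤ m * t) :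
    ∫ ω, sketchDeviation UX UZ e κ (S ω) ∂μ ≤ 3 * t := by
  have hUZr := transpose_mulVec_residual hUZ e
  have hpyth := euclNorm_sq_projection_add hUZ e
  unfold sketchDeviation
  generalize e - UZ *ᵥ (UZᵀ *ᵥ e) = r at hUZr hpyth ⊢
  generalize UZ *ᵥ (UZᵀ *ᵥ e) = f at hnormal hpyth ⊢
  have hmR : (0 : ℝ) < m := by exact_mod_cast hm
  have hpqR : (p : ℝ) ≤ q := by exact_mod_cast hpq
  have hi1 := hS.integrable_sum_sq hm UZ UZ
  have hi2 := hS.integrable_sum_sq hm UZ UX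
  have hi3 := hS.integrable_mulVec_sq hm hnormal
  have hi4 := hS.integrable_mulVec_sq hm hUZr
  have e1 : ∫ ω, ((∑ i, ∑ j, ((S ω * UZ)ᵀ * (S ω * UZ) - UZᵀ * UZ) i j ^ 2) +
      (∑ i, ∑ j, ((S ω * UZ)ᵀ * (S ω * UX) - UZᵀ * UX) i j ^ 2) +
      κ * (euclNorm ((S ω * UX)ᵀ *ᵥ (S ω *ᵥ f)) ^ 2 +
        euclNorm ((S ω * UZ)ᵀ *ᵥ (S ω *ᵥ r)) ^ 2)) ∂μ =
      (∫ ω, ∑ i, ∑ j, ((S ω * UZ)ᵀ * (S ω * UZ) - UZᵀ * UZ) i j ^ 2 ∂μ) +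
      (∫ ω, ∑ i, ∑ j, ((S ω * UZ)ᵀ * (S ω * UX) - UZᵀ * UX) i j ^ 2 ∂μ) +
      κ * ((∫ ω, euclNorm ((S ω * UX)ᵀ *ᵥ (S ω *ᵥ f)) ^ 2 ∂μ) +
        ∫ ω, euclNorm ((S ω * UZ)ᵀ *ᵥ (S ω *ᵥ r)) ^ 2 ∂μ) := by
    rw [← integral_add hi3 hi4, ← integral_const_mul, ← integral_add hi1 hi2]
    exact integral_add (hi1.add hi2) ((hi3.add hi4).const_mul κ)
  rw [e1]
  have b1 := hS.integral_sum_sq_le hm hUZ hUZ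
  have b2 := hS.integral_sum_sq_le hm hUZ hUX
  have b3 := hS.integral_mulVec_sq_le hm hUX hnormal
  have b4 := hS.integral_mulVec_sq_le hm hUZ hUZr
  have c1 : ∑ i, ∑ j, (UZᵀ * UZ) i j ^ 2 = (q : ℝ) := by
    rw [hUZ]; simp [one_apply]
  have c2 := sum_sq_transpose_mul_le hUZ hUX
  -- The first two means are at most `q(q+1)/m` and `2pq/m`, which is where the maximum in the
  -- condition on `m` comes from.
  have d1 : ((q : ℝ) * q + ∑ i, ∑ j, (UZᵀ * UZ) i j ^ 2) / m ≤ t := by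
    rw [c1, div_le_iff₀ hmR]; linarith
  have d2 : ((q : ℝ) * p + ∑ i, ∑ j, (UZᵀ * UX) i j ^ 2) / m ≤ t := by
    rw [div_le_iff₀ hmR]; linarith
  -- Enlarging `p` to `q` in the first term lets Pythagoras recombine the two parts of `e`.
  have d3 : κ * (p * euclNorm f ^ 2 / m + q * euclNorm r ^ 2 / m) ≤ t := by
    calc κ * (p * euclNorm f ^ 2 / m + q * euclNorm r ^ 2 / m)
        ≤ κ * (q * euclNorm f ^ 2 / m + q * euclNorm r ^ 2 / m) := by gcongr
      _ = q * (κ * euclNorm e ^ 2) / m := by rw [← hpyth]; ring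
      _ ≤ q * p / m := by gcongr
      _ ≤ t := by
        rw [div_le_iff₀ hmR]
        have : (0 : ℝ) ≤ p * q := by positivity
        linarith
  have d4 := mul_le_mul_of_nonneg_left (add_le_add b3 b4) hκ0
  linarith

end Deviation

/-! ### From small deviation to the final error bound. -/

/-- The two noise terms are small when the deviation of the sketch is. -/
theorem noise_add_le {n p q m : ℕ} {UX : Matrix (Fin n) (Fin p) ℝ} {UZ : Matrix (Fin n) (Fin q) ℝ}
    {e : Fin n → ℝ} {S : Matrix (Fin m) (Fin n) ℝ} {ε : ℝ} (hUZ : UZᵀ * UZ = 1) (hp : 0 < p)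
    (hε : 0 < ε)
    (hk : p / euclNorm e ^ 2 * (euclNorm ((S * UX)ᵀ *ᵥ (S *ᵥ (UZ *ᵥ (UZᵀ *ᵥ e)))) ^ 2 +
      euclNorm ((S * UZ)ᵀ *ᵥ (S *ᵥ (e - UZ *ᵥ (UZᵀ *ᵥ e)))) ^ 2) ≤ 3 * ε ^ 2) :
    euclNorm ((S * UX)ᵀ *ᵥ (S *ᵥ (UZ *ᵥ (UZᵀ *ᵥ e)))) +
      euclNorm ((S * UZ)ᵀ *ᵥ (S *ᵥ (e - UZ *ᵥ (UZᵀ *ᵥ e)))) ≤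
    5 / 2 * ε * (euclNorm e / √(p : ℝ)) := by
  have hpR : (0 : ℝ) < p := by exact_mod_cast hp
  have hpyth := euclNorm_sq_projection_add hUZ e
  generalize e - UZ *ᵥ (UZᵀ *ᵥ e) = r at hpyth hk ⊢
  generalize UZ *ᵥ (UZᵀ *ᵥ e) = f at hpyth hk ⊢
  have hen : 0 ≤ euclNorm e := euclNorm_nonneg e
  -- If `e = 0`, the weight is `p / 0 = 0` and `hk` says nothing, but then both parts of `e` vanish.
  rcases hen.eq_or_lt with h0 | hpos
  · rw [← h0] at hpyth
    have z1 : f = 0 := euclNorm_eq_zero.1 (by nlinarith [sq_nonneg (euclNorm r)])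
    have z2 : r = 0 := euclNorm_eq_zero.1 (by nlinarith [sq_nonneg (euclNorm f)])
    rw [z1, z2, ← h0]
    simp [euclNorm_eq_zero.2]
  · generalize euclNorm ((S * UX)ᵀ *ᵥ (S *ᵥ f)) = t1 at hk ⊢
    generalize euclNorm ((S * UZ)ᵀ *ᵥ (S *ᵥ r)) = t2 at hk ⊢
    have hk2 : t1 ^ 2 + t2 ^ 2 ≤ 3 * ε ^ 2 * (euclNorm e ^ 2 / p) := by
      rw [div_mul_eq_mul_div, div_le_iff₀ (by positivity)] at hk
      rw [← mul_div_assoc, le_div_iff₀ hpR]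
      linarith
    refine le_of_sq_le_sq ?_ (by positivity)
    have hsq : (5 / 2 * ε * (euclNorm e / √(p : ℝ))) ^ 2 =
        25 / 4 * ε ^ 2 * (euclNorm e ^ 2 / p) := by
      rw [mul_pow, div_pow, Real.sq_sqrt hpR.le]; ring
    have hnn : 0 ≤ ε ^ 2 * (euclNorm e ^ 2 / p) := by positivity
    rw [hsq]
    -- `(t1 + t2)² ≤ 2(t1² + t2²)` yields the factor `6 ≤ 25/4`.
    nlinarith [sq_nonneg (t1 - t2)]

theorem mainTheorem5 {n p q m : ℕ}
    (y : Fin n → ℝ) (X : Matrix (Fin n) (Fin p) ℝ) (Z : Matrix (Fin n) (Fin q) ℝ)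
    (hZ : IsUnit (Zᵀ * Z)) (hX : IsUnit (Xᵀ * projMatrix Z * X))
    (UX : Matrix (Fin n) (Fin p) ℝ) (sX : Fin p → ℝ) (VX : Matrix (Fin p) (Fin p) ℝ)
    (hUX : IsThinSVD X UX sX VX)
    (UZ : Matrix (Fin n) (Fin q) ℝ) (sZ : Fin q → ℝ) (VZ : Matrix (Fin q) (Fin q) ℝ)
    (hUZ : IsThinSVD Z UZ sZ VZ)
    {Ω : Type*} [MeasurableSpace Ω] (μ : Measure Ω) [IsProbabilityMeasure μ]
    (S : Ω → Matrix (Fin m) (Fin n) ℝ) (hS : IsCountSketch μ S)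
    (ε δ : ℝ) (hε : 0 < ε) (hε' : ε ≤ 1 / 3) (hδ : 0 < δ) (hδ' : δ < 1)
    (hm : max ((q : ℝ) * (q + 1)) (2 * p * q) / (ε ^ 2 * δ) ≤ (m : ℝ))
    (hσ : 16 * ε * (1 + ε) / (1 - ε) ≤ sigmaMin (UZᵀ * UX) ^ 2) :
    1 - δ ≤ μ.real {ω |
      IsUnit ((S ω * Z)ᵀ * (S ω * Z)) ∧
      IsUnit ((S ω * X)ᵀ * projMatrix (S ω * Z) * (S ω * X)) ∧
      euclNorm (twoSLS (S ω * X) (S ω * Z) (S ω *ᵥ y) - twoSLS X Z y) ≤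
        4 * ε / (1 - ε) * (2 + 3 * (euclNorm (twoSLSResidual X Z y) / √(p : ℝ))) *
          (sigmaMin X * sigmaMin (UZᵀ * UX) ^ 2)⁻¹} := by
  obtain ⟨E, rfl⟩ := hUX.exists_eq_mul
  obtain ⟨D, rfl⟩ := hUZ.exists_eq_mul
  have hUX1 := hUX.orthonormal
  have hUZ1 := hUZ.orthonormal
  have hD : IsUnit D := by
    rw [← Matrix.mul_assoc] at hZ
    exact isUnit_of_isUnit_mul_right hZ
  have hXinj : ∀ v, (UX * E) *ᵥ v = 0 → v = 0 := fun v hv => by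
    refine Matrix.mulVec_injective_iff_isUnit.2 hX ?_
    rw [mulVec_zero, ← mulVec_mulVec, hv, mulVec_zero]
  set s := sigmaMin (UZᵀ * UX) with hs
  have hs0 : 0 ≤ s := sigmaMin_nonneg _
  have h16 : 16 * ε ≤ s ^ 2 := by
    refine le_trans ?_ hσ
    rw [le_div_iff₀ (by linarith)]
    nlinarith
  have hspos : 0 < s := by
    rcases hs0.eq_or_lt with h | h
    · rw [← h] at h16; norm_num at h16; linarith
    · exact h
  have hp : 0 < p := by
    rcases Nat.eq_zero_or_pos p with rfl | h
    · exfalso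
      -- For `p = 0` the truncated index `min q 0 - 1` is `0`, beyond the rank, so the singular
      -- value is zero.
      have : s = 0 := LinearMap.singularValues_of_finrank_le _ (by simp)
      linarith
    · exact h
  have hpn : p ≤ n := le_of_mulVec_eq_zero hXinj
  have hσX : 0 < sigmaMin (UX * E) := sigmaMin_pos hpn hp hXinj
  have hpq : p ≤ q := le_of_mulVec_eq_zero (transpose_mul_mulVec_eq_zero hUZ1 hD hX)
  -- With `16ε ≤ s²`, this gives `2ε ≤ 1/8` and `2ε ≤ s/8`, the smallness required of `a = 2ε`.
  have hs1 : s ≤ 1 := by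
    have h1 := sigmaMin_mul_euclNorm_le hpq (UZᵀ * UX) (Pi.single ⟨0, hp⟩ 1)
    rw [← mulVec_mulVec] at h1
    have h2 := h1.trans (euclNorm_transpose_mulVec_le_of_orthonormal hUZ1 _)
    rw [euclNorm_mulVec_of_orthonormal hUX1] at h2
    have h3 : euclNorm (Pi.single ⟨0, hp⟩ 1 : Fin p → ℝ) = 1 := by simp [euclNorm]
    rwa [h3, mul_one] at h2
  have hq : 0 < q := hp.trans_le hpq
  have hpR : (0 : ℝ) < p := by exact_mod_cast hp
  have hqR : (0 : ℝ) < q := by exact_mod_cast hq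
  have hpqR : (p : ℝ) ≤ q := by exact_mod_cast hpq
  have hεδ : 0 < ε ^ 2 * δ := by positivity
  rw [div_le_iff₀ hεδ, max_le_iff] at hm
  obtain ⟨hm1, hm2⟩ := hm
  have hmR : (0 : ℝ) < m := by
    by_contra hc
    have : (0 : ℝ) < q * (q + 1) := by positivity
    nlinarith
  have hm0 : 0 < m := by exact_mod_cast hmR
  set e := twoSLSResidual (UX * E) (UZ * D) y with he
  have hnormal := normal_equations_factored hUZ1 hD hX y
  rw [← he] at hnormal
  -- This weight normalises the noise so that its mean is at most `pq/m`, on the scale of the other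
  -- two terms.
  set κ : ℝ := p / euclNorm e ^ 2 with hκ
  have hκ0 : 0 ≤ κ := by positivity
  have hκe : κ * euclNorm e ^ 2 ≤ p := by
    rcases eq_or_ne (euclNorm e ^ 2) 0 with h | h
    · rw [h, mul_zero]; exact hpR.le
    · rw [hκ, div_mul_cancel₀ _ h]
  have hint := hS.integral_sketchDeviation_le hm0 hUX1 hUZ1 hnormal hκ0 hκe hpq hm1 hm2
  rw [← mul_assoc] at hint
  refine (one_sub_le_measureReal_le (fun ω => sketchDeviation_nonneg hκ0 (S ω))
    (hS.integrable_sketchDeviation hm0 hUZ1 hnormal) (by positivity) hint).trans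
    (measureReal_mono ?_)
  intro ω hω
  obtain ⟨k1, k2, k3⟩ := sketchDeviation_bounds hκ0 (show sketchDeviation _ _ _ _ _ ≤ _ from hω)
  rw [hUZ1] at k1
  have k4 : 3 * ε ^ 2 ≤ (2 * ε) ^ 2 := by nlinarith [sq_nonneg ε]
  obtain ⟨u1, u2, u3⟩ := twoSLS_sketch_error hUX1 hUZ1 hD hX y (S ω) (a := 2 * ε) (by linarith)
    (by nlinarith) (by rw [← hs]; nlinarith) (k1.trans k4) (k2.trans k4) e he
  refine ⟨u1, u2, ?_⟩
  rw [← hs] at u3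
  have hnoise := noise_add_le hUZ1 hp hε k3
  rw [← div_eq_mul_inv, le_div_iff₀ (by positivity)]
  have hw : 0 ≤ euclNorm e / √(p : ℝ) := div_nonneg (euclNorm_nonneg e) (Real.sqrt_nonneg _)
  have hfac : 4 * ε ≤ 4 * ε / (1 - ε) := by
    rw [le_div_iff₀ (by linarith)]; nlinarith
  have hfin := mul_le_mul_of_nonneg_right hfac
    (by positivity : 0 ≤ 2 + 3 * (euclNorm e / √(p : ℝ)))
  have hεw : 0 ≤ ε * (euclNorm e / √(p : ℝ)) := mul_nonneg hε.le hw
  -- The noise coefficient is `(18/7) · (5/2) · ε = (45/7) ε ≤ 12 ε`; the summand `2` in the bracket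
  -- is slack.
  linarith
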